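/- Let $A,B,J$ be finite-dimensional complex Hilbert spaces with $|J|=\dim J\ge 1$, let $\mathcal N:\mathcal L(A\otimes J)\to\mathcal L(B)$ be a completely positive trace preserving (cptp) map, the quantum arbitrarily varying channel (QAVC), and let $\ell,L\ge 0$ be integers. For an operator $\zeta$ on $J^\ell=J^{\otimes\ell}$ let $\mathcal N^{\otimes\ell}_\zeta(\rho):=\mathcal N^{\otimes\ell}(\rho\otimes\zeta)$ for $\rho\in\mathcal L(A^\ell)$. A quantum code of block length $\ell$ and size $L$ is a pair $\mathcal Q=(\mathcal E,\mathcal D)$ of cptp maps $\mathcal E:\mathcal L(\mathbb C^L)\to\mathcal L(A^\ell)$ and $\mathcal D:\mathcal L(B^\ell)\to\mathcal L(\mathbb C^L)$; its infidelity with respect to a state $\zeta$ on $J^\ell$ is \[ \widehat F(\mathcal Q,\zeta):=1-\operatorname{tr}\Bigl(\bigl((\mathrm{id}\otimes\mathcal D\circ\mathcal N^{\otimes\ell}_\zeta\circ\mathcal E)\Phi_L\bigr)\,\Phi_L\Bigr),\qquad \Phi_L=\frac1L\sum_{i,j=1}^L|ii\rangle\langle jj| \quad(\Phi_0:=0). \]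 For $\pi\in S_\ell$ let $U^\pi$ be the unitary on an $\ell$-fold tensor power with $U^\pi|\alpha_1\rangle\cdots|\alpha_\ell\rangle=|\alpha_{\pi^{-1}(1)}\rangle\cdots|\alpha_{\pi^{-1}(\ell)}\rangle$, and let $\mathcal U_\pi(X)=U^\pi XU^{\pi\dagger}$. Let $\mathcal Q=(\mathcal E,\mathcal D)$ be a quantum code of block length $\ell$ and size $L$ and let $\epsilon\in\mathbb R$ be such that $\widehat F(\mathcal Q,\sigma^{\otimes\ell})\le\epsilon$ for all states $\sigma$ on $J$. Then the random quantum code $(\mathcal Q_\pi)_{\pi\in S_\ell}$, $\mathcal Q_\pi:=(\mathcal U_\pi\circ\mathcal E,\ \mathcal D\circ\mathcal U_{\pi^{-1}})$, with $\pi$ uniformly distributed on $S_\ell$, satisfies, for every state $\zeta$ on $J^\ell$, \[ \mathbb E_\pi\,\widehat F(\mathcal Q_\pi,\zeta)=\frac1{\ell!}\sum_{\pi\in S_\ell}\widehat F(\mathcal Q_\pi,\zeta)\le\epsilon\,(\ell+1)^{|J|^2}. \] -/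

import Mathlib

open scoped BigOperators Kronecker ComplexOrder

namespace QAVC

noncomputable section

/-! A finite-dimensional Hilbert space is `ℂ^m` for a finite index type `m`, so that the algebra of
operators on it is `Matrix m m ℂ`; tensor products are indexed by product types, and the `ℓ`-fold
tensor power is indexed by `Fin ℓ → m`. -/

/-- A state: a positive semidefinite operator of trace one. -/
def IsState {m : Type*} [Fintype m] (ρ : Matrix m m ℂ) : Prop :=
  ρ.PosSemidef ∧ ρ.trace = 1

/-- The map `id_r ⊗ Φ`, which applies `Φ` to each block of an operator on `ℂ^r ⊗ ℂ^m`. -/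
def ampliation (r : Type*) {m n : Type*} (Φ : Matrix m m ℂ →ₗ[ℂ] Matrix n n ℂ) :
    Matrix (r × m) (r × m) ℂ →ₗ[ℂ] Matrix (r × n) (r × n) ℂ where
  toFun X := Matrix.of fun p q => Φ (Matrix.of fun x y => X (p.1, x) (q.1, y)) p.2 q.2
  map_add' X Y := by
    ext p q
    exact congrFun (congrFun (Φ.map_add (Matrix.of fun x y => X (p.1, x) (q.1, y))
      (Matrix.of fun x y => Y (p.1, x) (q.1, y))) p.2) q.2
  map_smul' c X := by
    ext p q
    exact congrFun (congrFun (Φ.map_smul c (Matrix.of fun x y => X (p.1, x) (q.1, y))) p.2) q.2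

/-- Complete positivity: `id_{ℂ^k} ⊗ Φ` is positive for every `k`. -/
def IsCompletelyPositive {m n : Type*} (Φ : Matrix m m ℂ →ₗ[ℂ] Matrix n n ℂ) : Prop :=
  ∀ (k : ℕ) (X : Matrix (Fin k × m) (Fin k × m) ℂ),
    X.PosSemidef → (ampliation (Fin k) Φ X).PosSemidef

/-- Trace preservation. -/
def IsTracePreserving {m n : Type*} [Fintype m] [Fintype n]
    (Φ : Matrix m m ℂ →ₗ[ℂ] Matrix n n ℂ) : Prop :=
  ∀ X : Matrix m m ℂ, (Φ X).trace = X.trace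

/-- A quantum channel: a completely positive and trace preserving (cptp) linear map. -/
structure Channel (m n : Type*) [Fintype m] [Fintype n] where
  map : Matrix m m ℂ →ₗ[ℂ] Matrix n n ℂ
  completelyPositive : IsCompletelyPositive map
  tracePreserving : IsTracePreserving map

/-- The composition `Ψ ∘ Φ` of two channels. -/
def Channel.comp {m n p : Type*} [Fintype m] [Fintype n] [Fintype p]
    (Ψ : Channel n p) (Φ : Channel m n) : Channel m p where
  map := Ψ.map ∘ₗ Φ.map
  completelyPositive := fun k X hX =>
    Ψ.completelyPositive k _ (Φ.completelyPositive k X hX)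
  tracePreserving := fun X =>
    (Ψ.tracePreserving (Φ.map X)).trans (Φ.tracePreserving X)

/-- The tensor power `Φ^{⊗ℓ}` of a linear map, given by its values on the matrix units
`⨂ i, |x i⟩⟨x' i|`, each of which is sent to `⨂ i, Φ(|x i⟩⟨x' i|)`. -/
def tensorPowerMap {m n : Type*} [Fintype m] [DecidableEq m]
    (Φ : Matrix m m ℂ →ₗ[ℂ] Matrix n n ℂ) (ℓ : ℕ) :
    Matrix (Fin ℓ → m) (Fin ℓ → m) ℂ →ₗ[ℂ] Matrix (Fin ℓ → n) (Fin ℓ → n) ℂ where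
  toFun X := Matrix.of fun y y' =>
    ∑ x, ∑ x', X x x' * ∏ i, Φ (Matrix.single (x i) (x' i) 1) (y i) (y' i)
  map_add' X Y := by
    ext y y'
    simp [add_mul, Finset.sum_add_distrib]
  map_smul' c X := by
    ext y y'
    simp [mul_assoc, Finset.mul_sum]

/-- The tensor power `σ^{⊗ℓ}` of an operator. -/
def tensorPower {m : Type*} (σ : Matrix m m ℂ) (ℓ : ℕ) :
    Matrix (Fin ℓ → m) (Fin ℓ → m) ℂ :=
  Matrix.of fun x y => ∏ i, σ (x i) (y i)

/-- The map `N^{⊗ℓ}`, seen as a map on operators on `A^ℓ ⊗ J^ℓ`, for `N` a map on operators on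
`A ⊗ J`. -/
def blockMap {A J B : Type*} [Fintype A] [DecidableEq A] [Fintype J] [DecidableEq J]
    (N : Matrix (A × J) (A × J) ℂ →ₗ[ℂ] Matrix B B ℂ) (ℓ : ℕ) :
    Matrix ((Fin ℓ → A) × (Fin ℓ → J)) ((Fin ℓ → A) × (Fin ℓ → J)) ℂ →ₗ[ℂ]
      Matrix (Fin ℓ → B) (Fin ℓ → B) ℂ :=
  tensorPowerMap N ℓ ∘ₗ
    (Matrix.reindexLinearEquiv ℂ ℂ (Equiv.arrowProdEquivProdArrow (Fin ℓ) (fun _ => A) (fun _ => J)).symm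
      (Equiv.arrowProdEquivProdArrow (Fin ℓ) (fun _ => A) (fun _ => J)).symm).toLinearMap

/-- The map `M_σ : ρ ↦ M (ρ ⊗ σ)`, where the jammer's input is fixed to `σ`. -/
def fixJammer {A J B : Type*} (M : Matrix (A × J) (A × J) ℂ →ₗ[ℂ] Matrix B B ℂ)
    (σ : Matrix J J ℂ) : Matrix A A ℂ →ₗ[ℂ] Matrix B B ℂ where
  toFun ρ := M (ρ ⊗ₖ σ)
  map_add' ρ ρ' := by rw [Matrix.add_kronecker, map_add]
  map_smul' c ρ := by rw [Matrix.smul_kronecker, map_smul, RingHom.id_apply]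

/-- The maximally entangled state `Φ_L = (1/L) ∑_{i,j} |ii⟩⟨jj|`. -/
def maxEntangled (L : ℕ) : Matrix (Fin L × Fin L) (Fin L × Fin L) ℂ :=
  Matrix.of fun p q => if p.1 = p.2 ∧ q.1 = q.2 then (1 : ℂ) / L else 0

/-- A (deterministic) quantum code of block length `ℓ` and size `L`: a pair of channels. -/
structure QuantumCode (A B : Type*) [Fintype A] [Fintype B] (ℓ L : ℕ) where
  enc : Channel (Fin L) (Fin ℓ → A)
  dec : Channel (Fin ℓ → B) (Fin L)

/-- The infidelity `1 - tr ((id ⊗ D ∘ (N^{⊗ℓ})_ζ ∘ E) Φ_L) Φ_L` of a code `(E, D)` with respect to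
an operator `ζ` on `J^ℓ`. (For a state `ζ` this trace is a real number.) -/
def infidelity {A J B : Type*} [Fintype A] [DecidableEq A] [Fintype J] [DecidableEq J] [Fintype B]
    (N : Channel (A × J) B) {ℓ L : ℕ} (Q : QuantumCode A B ℓ L)
    (ζ : Matrix (Fin ℓ → J) (Fin ℓ → J) ℂ) : ℝ :=
  1 - (ampliation (Fin L) (Q.dec.map ∘ₗ fixJammer (blockMap N.map ℓ) ζ ∘ₗ Q.enc.map)
        (maxEntangled L) * maxEntangled L).trace.re

/-- The permutation operator `U^π |x 1⟩ ⋯ |x ℓ⟩ = |x (π⁻¹ 1)⟩ ⋯ |x (π⁻¹ ℓ)⟩` on a tensor power. -/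
def permOp (m : Type*) [DecidableEq m] {ℓ : ℕ} (π : Equiv.Perm (Fin ℓ)) :
    Matrix (Fin ℓ → m) (Fin ℓ → m) ℂ :=
  Matrix.of fun y x => if y = x ∘ ⇑π⁻¹ then 1 else 0

theorem permOp_unitary (m : Type*) [Fintype m] [DecidableEq m] {ℓ : ℕ}
    (π : Equiv.Perm (Fin ℓ)) : (permOp m π).conjTranspose * permOp m π = 1 := by
  ext x y
  have h : (x ∘ ⇑π⁻¹ = y ∘ ⇑π⁻¹) ↔ x = y :=
    (Equiv.surjective π⁻¹).injective_comp_right.eq_iff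
  simp only [permOp, Matrix.mul_apply, Matrix.conjTranspose_apply, Matrix.of_apply,
    Matrix.one_apply, apply_ite star, star_one, star_zero, ite_mul, one_mul, zero_mul,
    Finset.sum_ite_eq', Finset.mem_univ, if_true, h]

/-- The conjugation `X ↦ U X U†`. -/
def conjMap {m : Type*} [Fintype m] (U : Matrix m m ℂ) : Matrix m m ℂ →ₗ[ℂ] Matrix m m ℂ where
  toFun X := U * X * U.conjTranspose
  map_add' X Y := by rw [mul_add, add_mul]
  map_smul' c X := by simp

theorem ampliation_conjMap {m : Type*} [Fintype m] (U : Matrix m m ℂ) (k : ℕ)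
    (X : Matrix (Fin k × m) (Fin k × m) ℂ) :
    ampliation (Fin k) (conjMap U) X =
      ((1 : Matrix (Fin k) (Fin k) ℂ) ⊗ₖ U) * X *
        ((1 : Matrix (Fin k) (Fin k) ℂ) ⊗ₖ U).conjTranspose := by
  ext p q
  simp [ampliation, conjMap, Matrix.mul_apply, Fintype.sum_prod_type, Matrix.one_apply,
    apply_ite star, ite_mul, mul_ite, Finset.sum_ite_irrel]

/-- The channel `𝒰_π : X ↦ U^π X U^{π†}`. -/
def permChannel (m : Type*) [Fintype m] [DecidableEq m] {ℓ : ℕ} (π : Equiv.Perm (Fin ℓ)) :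
    Channel (Fin ℓ → m) (Fin ℓ → m) where
  map := conjMap (permOp m π)
  completelyPositive := fun k X hX => by
    rw [ampliation_conjMap]
    exact hX.mul_mul_conjTranspose_same _
  tracePreserving := fun X => by
    change (permOp m π * X * (permOp m π).conjTranspose).trace = X.trace
    rw [Matrix.trace_mul_comm, ← mul_assoc, permOp_unitary, one_mul]

/-- The permuted code `Q_π = (𝒰_π ∘ E, D ∘ 𝒰_{π⁻¹})`. -/
def QuantumCode.permute {A B : Type*} [Fintype A] [DecidableEq A] [Fintype B] [DecidableEq B]
    {ℓ L : ℕ} (Q : QuantumCode A B ℓ L) (π : Equiv.Perm (Fin ℓ)) : QuantumCode A B ℓ L where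
  enc := (permChannel A π).comp Q.enc
  dec := Q.dec.comp (permChannel B π⁻¹)

/-- The error of a random quantum code `(Q_λ)` with `λ` uniformly distributed on a finite set: the
expectation over `λ` of the infidelity. -/
def randomInfidelity {A J B : Type*} [Fintype A] [DecidableEq A] [Fintype J] [DecidableEq J]
    [Fintype B] (N : Channel (A × J) B) {ℓ L : ℕ} {Λ : Type*} [Fintype Λ]
    (Q : Λ → QuantumCode A B ℓ L) (ζ : Matrix (Fin ℓ → J) (Fin ℓ → J) ℂ) : ℝ :=
  (∑ lam, infidelity N (Q lam) ζ) / Fintype.card Λ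

end

end QAVC

namespace QAVC

open MeasureTheory

/-! ### Moments of the exponential distribution -/

/-! The channel `N^{⊗ℓ}` commutes with permutations of the tensor factors, so permuting the code
amounts to permuting the jammer's operator. The averaged infidelity is therefore `F(ζ̄)`, with `ζ̄`
the symmetrization of `ζ` and `F` the infidelity made linear in `ζ` (`randomInfidelity_permute`).
Since `F` is positive (`errorFunctional_nonneg`), `F(R R†) = ‖S R‖²` for a fixed `S`. The positive
square root `R` of `ζ̄` is unique, hence permutation invariant: it is a symmetric tensor in `(J ⊗
J)^{⊗ℓ}`, and this is where the exponent `|J|²` arises.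

It remains to bound a positive quadratic form on symmetric tensors over `ℂ^n` by its values on
powers `w^{⊗ℓ}` (`sum_norm_sq_le_of_symmetric`). By Cauchy–Schwarz, its value at a symmetric unit
tensor is at most its trace over the symmetric subspace. Up to the factor `ℓ!`, the projection onto
that subspace is the mean of `|w^{⊗ℓ}⟩⟨w^{⊗ℓ}|` over a complex Gaussian `w`. Hence `ℓ!` times the
trace is at most `ε E‖w‖^{2ℓ}`, which is `ε ℓ!` times the number of types, and there are at most
`(ℓ+1)^n` types.

The Gaussian mean is taken in two stages. The moduli satisfy `|w_j|² = p_j` with `p_j` exponential,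
so that `E p_j^k = k!` (`sum_mul_prod_factorial_le`). The phases run over the `(ℓ+1)`-th roots of
unity, which suffices in degree `ℓ` (`sum_phase_prod`). -/

theorem integrable_pow_exponential (k : ℕ) :
    Integrable (fun x : ℝ => x ^ k * Real.exp (-x)) (volume.restrict (Set.Ioi 0)) := by
  have h := Real.GammaIntegral_convergent (s := (k : ℝ) + 1) (by positivity)
  refine h.congr (ae_of_all _ fun x => ?_)
  simp [mul_comm]

theorem integral_pow_exponential (k : ℕ) :
    ∫ x : ℝ, x ^ k * Real.exp (-x) ∂(volume.restrict (Set.Ioi 0)) = (k.factorial : ℝ) := by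
  rw [← Real.Gamma_nat_eq_factorial, Real.Gamma_eq_integral (by positivity)]
  refine integral_congr_ae (ae_of_all _ fun x => ?_)
  simp [mul_comm]

variable {n : Type*} [Fintype n]

theorem integrable_monomial_exponential (e : n → ℕ) :
    Integrable (fun p : n → ℝ => (∏ j, p j ^ e j) * ∏ j, Real.exp (-p j))
      (Measure.pi fun _ => volume.restrict (Set.Ioi 0)) := by
  simp_rw [← Finset.prod_mul_distrib]
  exact Integrable.fintype_prod (f := fun j x => x ^ e j * Real.exp (-x))
    fun j => integrable_pow_exponential (e j)

theorem integral_monomial_exponential (e : n → ℕ) :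
    ∫ p : n → ℝ, (∏ j, p j ^ e j) * ∏ j, Real.exp (-p j)
      ∂(Measure.pi fun _ => volume.restrict (Set.Ioi 0)) = ∏ j, ((e j).factorial : ℝ) := by
  simp_rw [← Finset.prod_mul_distrib]
  rw [integral_fintype_prod_eq_prod (fun j x => x ^ e j * Real.exp (-x))]
  exact Finset.prod_congr rfl fun j _ => integral_pow_exponential (e j)

theorem polynomial_exponential {α : Type*} (u : Finset α) (a : α → ℝ) (g : α → n → ℕ) :
    Integrable (fun p : n → ℝ => (∑ i ∈ u, a i * ∏ j, p j ^ g i j) * ∏ j, Real.exp (-p j))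
        (Measure.pi fun _ => volume.restrict (Set.Ioi 0)) ∧
      ∫ p : n → ℝ, (∑ i ∈ u, a i * ∏ j, p j ^ g i j) * ∏ j, Real.exp (-p j)
        ∂(Measure.pi fun _ => volume.restrict (Set.Ioi 0)) =
      ∑ i ∈ u, a i * ∏ j, ((g i j).factorial : ℝ) := by
  simp_rw [Finset.sum_mul, mul_assoc]
  refine ⟨integrable_finsetSum _ fun i _ =>
    (integrable_monomial_exponential (g i)).const_mul _, ?_⟩
  rw [integral_finsetSum _ fun i _ => (integrable_monomial_exponential (g i)).const_mul _]
  simp_rw [integral_const_mul, integral_monomial_exponential]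

/-- An inequality between polynomials on the positive orthant survives the replacement of each
monomial `∏ j, p j ^ e j` by `∏ j, (e j)!`. -/
theorem sum_mul_prod_factorial_le {ι κ : Type*} (s : Finset ι) (t : Finset κ)
    (c : ι → ℝ) (d : κ → ℝ) (e : ι → n → ℕ) (f : κ → n → ℕ)
    (h : ∀ p : n → ℝ, (∀ j, 0 ≤ p j) →
      ∑ i ∈ s, c i * ∏ j, p j ^ e i j ≤ ∑ i ∈ t, d i * ∏ j, p j ^ f i j) :
    ∑ i ∈ s, c i * ∏ j, ((e i j).factorial : ℝ) ≤
      ∑ i ∈ t, d i * ∏ j, ((f i j).factorial : ℝ) := by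
  rw [← (polynomial_exponential s c e).2, ← (polynomial_exponential t d f).2]
  refine integral_mono_ae (polynomial_exponential s c e).1 (polynomial_exponential t d f).1 ?_
  have hpos : ∀ᵐ p : n → ℝ ∂(Measure.pi fun _ => volume.restrict (Set.Ioi (0 : ℝ))),
      ∀ j, 0 ≤ p j := by
    rw [ae_all_iff]
    intro j
    refine (Measure.tendsto_eval_ae_ae (i := j)).eventually ?_
    filter_upwards [ae_restrict_mem measurableSet_Ioi] with x hx using le_of_lt hx
  filter_upwards [hpos] with p hp
  exact mul_le_mul_of_nonneg_right (h p hp) (by positivity)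

/-! ### Words and their types -/

/-- The type of a word: the number of occurrences of each letter. -/
def wordType {n : Type*} {ℓ : ℕ} [DecidableEq n] (x : Fin ℓ → n) (j : n) : ℕ := Fintype.card {i // x i = j}

variable [DecidableEq n] {ℓ : ℕ}

theorem wordType_le {n : Type*} [DecidableEq n] (x : Fin ℓ → n) (j : n) : wordType x j ≤ ℓ := by
  simpa [wordType] using Fintype.card_subtype_le (fun i => x i = j)

theorem prod_comp_eq_prod_pow_wordType {M : Type*} [CommMonoid M] (x : Fin ℓ → n) (f : n → M) :
    ∏ i, f (x i) = ∏ j, f j ^ wordType x j := by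
  rw [← Finset.prod_fiberwise' Finset.univ x f]
  refine Finset.prod_congr rfl fun j _ => ?_
  rw [Finset.prod_const, wordType, Fintype.card_subtype]

theorem wordType_comp_perm {n : Type*} [DecidableEq n] (x : Fin ℓ → n) (π : Equiv.Perm (Fin ℓ)) :
    wordType (x ∘ π) = wordType x := by
  funext j
  exact Fintype.card_congr (π.subtypeEquiv fun a => Iff.rfl)

/-- For each letter, the sets of its positions in the two words have equal size; bijections between
these fibres glue to a permutation. -/
theorem exists_perm_of_wordType_eq {n : Type*} [DecidableEq n] {x y : Fin ℓ → n} (h : wordType x = wordType y) :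
    ∃ π : Equiv.Perm (Fin ℓ), x ∘ π = y := by
  let e : ∀ j, {i // y i = j} ≃ {i // x i = j} := fun j =>
    Fintype.equivOfCardEq (congrFun h j).symm
  refine ⟨(Equiv.sigmaFiberEquiv y).symm.trans
    ((Equiv.sigmaCongrRight e).trans (Equiv.sigmaFiberEquiv x)), ?_⟩
  funext i
  exact (e (y i) ⟨i, rfl⟩).2

/-- The number of permutations that carry one word to another. -/
theorem card_perm_comp_eq (x y : Fin ℓ → n) :
    Fintype.card {π : Equiv.Perm (Fin ℓ) // x ∘ π = y} =
      if wordType x = wordType y then ∏ j, (wordType x j).factorial else 0 := by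
  split_ifs with h
  · obtain ⟨π, rfl⟩ := exists_perm_of_wordType_eq h
    -- The permutations in question form a coset of the stabilizer of `x`.
    refine Eq.trans ?_ (DomMulAct.stabilizer_card x)
    refine Fintype.card_congr ((Equiv.mulRight π⁻¹).subtypeEquiv fun g => ?_)
    constructor
    · intro hg
      funext i
      simpa using congrFun hg (π⁻¹ i)
    · intro hg
      funext i
      simpa using congrFun hg (π i)
  · rw [Fintype.card_eq_zero_iff]
    exact ⟨fun π => h (by rw [← π.2, wordType_comp_perm])⟩

/-! ### Averaging over phases -/

/-- A geometric sum with ratio `ω^(a-b)`. Order `ℓ + 1` is enough because exponents in `0, …, ℓ` are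
distinct modulo `ℓ + 1`. -/
theorem sum_rootOfUnity_pow_mul_star_pow {ω : ℂ} (hω : IsPrimitiveRoot ω (ℓ + 1)) {a b : ℕ}
    (ha : a ≤ ℓ) (hb : b ≤ ℓ) :
    ∑ k : Fin (ℓ + 1), (ω ^ (k : ℕ)) ^ a * star (ω ^ (k : ℕ)) ^ b =
      if a = b then ((ℓ : ℂ) + 1) else 0 := by
  have hnorm : ‖ω‖ = 1 := hω.norm'_eq_one (by simp)
  have hne : ω ≠ 0 := hω.ne_zero (by simp)
  have hstar : star ω = ω⁻¹ := by
    rw [Complex.inv_eq_conj hnorm]; rfl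
  have hterm : ∀ k : Fin (ℓ + 1), (ω ^ (k : ℕ)) ^ a * star (ω ^ (k : ℕ)) ^ b =
      (ω ^ a * (ω⁻¹) ^ b) ^ (k : ℕ) := by
    intro k
    rw [star_pow, hstar, mul_pow, ← pow_mul, ← pow_mul, ← pow_mul, ← pow_mul, mul_comm a,
      mul_comm b]
  simp_rw [hterm]
  rw [Fin.sum_univ_eq_sum_range (fun k => (ω ^ a * (ω⁻¹) ^ b) ^ k)]
  split_ifs with h
  · subst h
    simp [hne]
  · have h1 : ω ^ a * (ω⁻¹) ^ b ≠ 1 := by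
      intro h1
      apply h
      refine hω.pow_inj (by omega) (by omega) ?_
      rw [inv_pow] at h1
      exact (mul_inv_eq_one₀ (pow_ne_zero _ hne)).1 h1
    have h3 : (ω ^ a * (ω⁻¹) ^ b) ^ (ℓ + 1) = 1 := by
      rw [mul_pow, pow_right_comm ω, pow_right_comm ω⁻¹, inv_pow, hω.pow_eq_one]
      simp
    have h2 := mul_geom_sum (ω ^ a * (ω⁻¹) ^ b) (ℓ + 1)
    rw [h3, sub_self] at h2
    exact (mul_eq_zero.1 h2).resolve_left (sub_ne_zero.2 h1)

/-- Averaging over the phases of `w` kills the products of words of different types. -/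
theorem sum_phase_prod {ω : ℂ} (hω : IsPrimitiveRoot ω (ℓ + 1)) (p : n → ℝ) (hp : ∀ j, 0 ≤ p j)
    (x y : Fin ℓ → n) :
    ∑ k : n → Fin (ℓ + 1), (∏ i, (Real.sqrt (p (x i)) * ω ^ (k (x i) : ℕ) : ℂ)) *
        star (∏ i, (Real.sqrt (p (y i)) * ω ^ (k (y i) : ℕ) : ℂ)) =
      ((ℓ : ℂ) + 1) ^ Fintype.card n *
        if wordType x = wordType y then ∏ j, (p j : ℂ) ^ wordType x j else 0 := by
  have hterm : ∀ k : n → Fin (ℓ + 1),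
      (∏ i, (Real.sqrt (p (x i)) * ω ^ (k (x i) : ℕ) : ℂ)) *
        star (∏ i, (Real.sqrt (p (y i)) * ω ^ (k (y i) : ℕ) : ℂ)) =
      ∏ j, ((Real.sqrt (p j) : ℂ) ^ wordType x j * (Real.sqrt (p j) : ℂ) ^ wordType y j *
        ((ω ^ (k j : ℕ)) ^ wordType x j * star (ω ^ (k j : ℕ)) ^ wordType y j)) := by
    intro k
    rw [prod_comp_eq_prod_pow_wordType x (fun j => (Real.sqrt (p j) * ω ^ (k j : ℕ) : ℂ)),
      prod_comp_eq_prod_pow_wordType y (fun j => (Real.sqrt (p j) * ω ^ (k j : ℕ) : ℂ)),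
      star_prod, ← Finset.prod_mul_distrib]
    refine Finset.prod_congr rfl fun j _ => ?_
    have : star (Real.sqrt (p j) : ℂ) = Real.sqrt (p j) := Complex.conj_ofReal _
    rw [star_pow, star_mul', this, mul_pow, mul_pow]
    ring
  simp_rw [hterm]
  rw [← Fintype.prod_sum (fun (j : n) (k : Fin (ℓ + 1)) =>
    ((Real.sqrt (p j) : ℂ) ^ wordType x j * (Real.sqrt (p j) : ℂ) ^ wordType y j *
        ((ω ^ (k : ℕ)) ^ wordType x j * star (ω ^ (k : ℕ)) ^ wordType y j)))]
  simp_rw [← Finset.mul_sum, sum_rootOfUnity_pow_mul_star_pow hω (wordType_le x _)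
    (wordType_le y _)]
  split_ifs with h
  · have hj : ∀ j, (Real.sqrt (p j) : ℂ) ^ wordType x j * (Real.sqrt (p j) : ℂ) ^ wordType y j =
        (p j : ℂ) ^ wordType x j := by
      intro j
      rw [← h, ← mul_pow, ← Complex.ofReal_mul, Real.mul_self_sqrt (hp j)]
    simp_rw [hj, h, if_true, Finset.prod_mul_distrib]
    simp [mul_comm]
  · obtain ⟨j, hj⟩ := Function.ne_iff.1 h
    -- One letter with different multiplicities already makes its factor vanish.
    rw [mul_zero]
    exact Finset.prod_eq_zero (Finset.mem_univ j) (by rw [if_neg hj, mul_zero])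

/-- Each of the multiplicities takes one of the `ℓ + 1` values `0, …, ℓ`. -/
theorem card_piAntidiag_univ_le (ℓ : ℕ) :
    (Finset.piAntidiag (Finset.univ : Finset n) ℓ).card ≤ (ℓ + 1) ^ Fintype.card n := by
  have hsub : Finset.piAntidiag (Finset.univ : Finset n) ℓ ⊆
      Fintype.piFinset fun _ : n => Finset.range (ℓ + 1) := by
    intro t ht
    rw [Fintype.mem_piFinset]
    intro j
    rw [Finset.mem_range, Nat.lt_succ_iff, ← (Finset.mem_piAntidiag.1 ht).1]
    exact Finset.single_le_sum (fun _ _ => Nat.zero_le _) (Finset.mem_univ j)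
  simpa using Finset.card_le_card hsub

/-- The exponential moment of `(∑ j, p j) ^ ℓ`. -/
theorem sum_multinomial_mul_factorial (ℓ : ℕ) :
    ∑ t ∈ Finset.piAntidiag (Finset.univ : Finset n) ℓ,
        (Nat.multinomial Finset.univ t : ℝ) * ∏ j, ((t j).factorial : ℝ) =
      (Finset.piAntidiag (Finset.univ : Finset n) ℓ).card * (ℓ.factorial : ℝ) := by
  rw [← nsmul_eq_mul]
  refine Finset.sum_eq_card_nsmul fun t ht => ?_
  have h := Nat.multinomial_spec Finset.univ t
  rw [(Finset.mem_piAntidiag.1 ht).1, mul_comm] at h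
  exact_mod_cast h

end QAVC

/-! ### Positive quadratic forms on symmetric tensors -/

namespace QAVC

variable {n : Type*} [Fintype n] [DecidableEq n] {ℓ : ℕ}

theorem ofReal_norm_sq_sum_mul {α : Type*} [Fintype α] (K u : α → ℂ) :
    ((‖∑ x, K x * u x‖ ^ 2 : ℝ) : ℂ) =
      ∑ x, ∑ y, K x * star (K y) * (u x * star (u y)) := by
  rw [Complex.ofReal_pow, ← Complex.mul_conj', map_sum, Finset.sum_mul_sum]
  refine Finset.sum_congr rfl fun x _ => Finset.sum_congr rfl fun y _ => ?_
  rw [map_mul]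
  simp only [Complex.star_def]
  ring

/-- The symmetrization of a form on words. -/
theorem sum_perm_mul_star_eq (K : (Fin ℓ → n) → ℂ) :
    ∑ π : Equiv.Perm (Fin ℓ), ∑ x, K x * star (K (x ∘ π)) =
      ∑ x, ∑ y, K x * star (K y) *
        (if wordType x = wordType y then ∏ j, ((wordType x j).factorial : ℂ) else 0) := by
  rw [Finset.sum_comm]
  refine Finset.sum_congr rfl fun x _ => ?_
  rw [← Finset.sum_fiberwise Finset.univ (fun π : Equiv.Perm (Fin ℓ) => x ∘ π)]
  refine Finset.sum_congr rfl fun y _ => ?_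
  have h := card_perm_comp_eq x y
  rw [Fintype.card_subtype] at h
  rw [Finset.sum_congr rfl (g := fun _ => K x * star (K y)) (by
    intro π hπ
    rw [(Finset.mem_filter.1 hπ).2]), Finset.sum_const, h, nsmul_eq_mul, mul_comm]
  push_cast
  rfl

/-- Cauchy–Schwarz for a form evaluated at a symmetric tensor. -/
theorem norm_sq_sum_mul_le_of_symmetric {n : Type*} [Fintype n] (K R : (Fin ℓ → n) → ℂ)
    (hR : ∀ (π : Equiv.Perm (Fin ℓ)) x, R (x ∘ π) = R x) :
    ℓ.factorial * ‖∑ x, K x * R x‖ ^ 2 ≤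
      (∑ π : Equiv.Perm (Fin ℓ), ∑ x, K x * star (K (x ∘ π))).re * ∑ x, ‖R x‖ ^ 2 := by
  have hsum : ∀ (π : Equiv.Perm (Fin ℓ)) (f : (Fin ℓ → n) → ℂ), ∑ x, f (x ∘ π) = ∑ x, f x :=
    fun π f => Equiv.sum_comp (π.symm.arrowCongr (Equiv.refl n)) f
  -- Pairing with the symmetric `R` sees only the symmetrization `T` of `K`, so Cauchy–Schwarz can
  -- be applied to `T`, whose norm is the symmetrized form.
  set T : (Fin ℓ → n) → ℂ := fun x => ∑ π : Equiv.Perm (Fin ℓ), K (x ∘ π) with hT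
  have hcard : ((ℓ.factorial : ℕ) : ℂ) = ∑ _π : Equiv.Perm (Fin ℓ), 1 := by
    simp [Fintype.card_perm]
  have h1 : (ℓ.factorial : ℂ) * ∑ x, K x * R x = ∑ x, T x * R x := by
    simp_rw [hT, Finset.sum_mul]
    rw [Finset.sum_comm, hcard, Finset.sum_mul]
    refine Finset.sum_congr rfl fun π _ => ?_
    rw [one_mul, ← hsum π]
    exact Finset.sum_congr rfl fun x _ => by rw [hR]
  have h2 : (∑ x, ‖T x‖ ^ 2 : ℝ) =
      ℓ.factorial * (∑ π : Equiv.Perm (Fin ℓ), ∑ x, K x * star (K (x ∘ π))).re := by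
    have h2c : ((∑ x, ‖T x‖ ^ 2 : ℝ) : ℂ) =
        (ℓ.factorial : ℂ) * ∑ π : Equiv.Perm (Fin ℓ), ∑ x, K x * star (K (x ∘ π)) := by
      rw [hcard, Finset.sum_mul, Complex.ofReal_sum]
      have hx : ∀ x, ((‖T x‖ ^ 2 : ℝ) : ℂ) =
          ∑ π : Equiv.Perm (Fin ℓ), ∑ ρ : Equiv.Perm (Fin ℓ), K (x ∘ π) * star (K (x ∘ ρ)) := by
        intro x
        rw [Complex.ofReal_pow, ← Complex.mul_conj', hT, map_sum, Finset.sum_mul_sum]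
        rfl
      simp_rw [hx]
      rw [Finset.sum_comm]
      refine Finset.sum_congr rfl fun π _ => ?_
      -- Replacing `ρ` by `π * ρ` makes the summand a function of `x ∘ π`, so the sum over `x` no
      -- longer depends on `π`.
      rw [one_mul, Finset.sum_comm, ← Equiv.sum_comp (Equiv.mulLeft π)]
      refine Finset.sum_congr rfl fun ρ _ => ?_
      exact hsum π fun x => K x * star (K (x ∘ ρ))
    have := congrArg Complex.re h2c
    rwa [Complex.ofReal_re, ← Complex.ofReal_natCast, Complex.re_ofReal_mul] at this
  have h3 : ‖∑ x, T x * R x‖ ^ 2 ≤ (∑ x, ‖T x‖ ^ 2) * ∑ x, ‖R x‖ ^ 2 := by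
    calc ‖∑ x, T x * R x‖ ^ 2 ≤ (∑ x, ‖T x‖ * ‖R x‖) ^ 2 := by
          gcongr
          exact (norm_sum_le _ _).trans_eq (by simp)
      _ ≤ _ := Finset.sum_mul_sq_le_sq_mul_sq _ _ _
  rw [← h1, h2, norm_mul, mul_pow, Complex.norm_natCast] at h3
  have h4 : (0 : ℝ) < ℓ.factorial := by positivity
  refine le_of_mul_le_mul_left ?_ h4
  calc _ = (ℓ.factorial : ℝ) ^ 2 * ‖∑ x, K x * R x‖ ^ 2 := by ring
    _ ≤ _ := h3
    _ = _ := by ring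

/-- A positive quadratic form on tensors that is at most `ε` on the powers of unit vectors is at
most `ε (ℓ + 1) ^ n` on symmetric unit tensors. -/
theorem sum_norm_sq_le_of_symmetric {κ : Type*} [Fintype κ] (K : κ → (Fin ℓ → n) → ℂ) (ε : ℝ)
    (hε : 0 ≤ ε)
    (h : ∀ w : n → ℂ, ∑ a, ‖∑ x, K a x * ∏ i, w (x i)‖ ^ 2 ≤ ε * (∑ j, ‖w j‖ ^ 2) ^ ℓ)
    (R : (Fin ℓ → n) → ℂ) (hR : ∀ (π : Equiv.Perm (Fin ℓ)) x, R (x ∘ π) = R x) :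
    ∑ a, ‖∑ x, K a x * R x‖ ^ 2 ≤
      ε * ((ℓ : ℝ) + 1) ^ Fintype.card n * ∑ x, ‖R x‖ ^ 2 := by
  -- The coefficients of the form at `w^{⊗ℓ}` after averaging over the phases of `w`: a polynomial
  -- in `p_j = |w_j|²`.
  set c : (Fin ℓ → n) × (Fin ℓ → n) → ℝ := fun z =>
    if wordType z.1 = wordType z.2 then (∑ a, K a z.1 * star (K a z.2)).re else 0 with hc
  have hpoly : ∀ p : n → ℝ, (∀ j, 0 ≤ p j) →
      ∑ z, c z * ∏ j, p j ^ wordType z.1 j ≤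
        ∑ t ∈ Finset.piAntidiag (Finset.univ : Finset n) ℓ,
          (ε * Nat.multinomial Finset.univ t) * ∏ j, p j ^ t j := by
    intro p hp
    obtain ⟨ω, hω⟩ : ∃ ω : ℂ, IsPrimitiveRoot ω (ℓ + 1) :=
      ⟨_, Complex.isPrimitiveRoot_exp _ (by simp)⟩
    have hnorm : ‖ω‖ = 1 := hω.norm'_eq_one (by simp)
    simp_rw [mul_assoc]
    rw [← Finset.mul_sum, ← Finset.sum_pow_eq_sum_piAntidiag]
    -- The vector `w_j = √(p_j) ω^(k_j)` has squared norm `∑ p_j`, whatever the phases.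
    have hk : ∀ k : n → Fin (ℓ + 1),
        ∑ a, ‖∑ x, K a x * ∏ i, (Real.sqrt (p (x i)) * ω ^ (k (x i) : ℕ) : ℂ)‖ ^ 2 ≤
          ε * (∑ j, p j) ^ ℓ := by
      intro k
      refine (h fun j => Real.sqrt (p j) * ω ^ (k j : ℕ)).trans_eq ?_
      congr 3
      funext j
      rw [norm_mul, norm_pow, hnorm, one_pow, mul_one, Complex.norm_real, Real.norm_eq_abs, sq_abs,
        Real.sq_sqrt (hp j)]
    have hsum := Finset.sum_le_sum fun k (_ : k ∈ (Finset.univ : Finset (n → Fin (ℓ + 1)))) => hk k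
    rw [Finset.sum_const, Finset.card_univ, Fintype.card_fun, Fintype.card_fin, nsmul_eq_mul,
      Nat.cast_pow, Nat.cast_add_one] at hsum
    have hpow : (0 : ℝ) < ((ℓ : ℝ) + 1) ^ Fintype.card n := by positivity
    refine le_of_mul_le_mul_left (le_of_eq_of_le ?_ hsum) hpow
    have hcx : ((∑ k : n → Fin (ℓ + 1), ∑ a, ‖∑ x, K a x *
          ∏ i, (Real.sqrt (p (x i)) * ω ^ (k (x i) : ℕ) : ℂ)‖ ^ 2 : ℝ) : ℂ) =
        (((ℓ : ℝ) + 1) ^ Fintype.card n : ℝ) * ∑ z : (Fin ℓ → n) × (Fin ℓ → n),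
          (∑ a, K a z.1 * star (K a z.2)) *
            ((if wordType z.1 = wordType z.2 then ∏ j, p j ^ wordType z.1 j else 0 : ℝ) : ℂ) := by
      simp_rw [Complex.ofReal_sum, ofReal_norm_sq_sum_mul, Fintype.sum_prod_type]
      rw [Finset.sum_comm, Finset.mul_sum]
      simp_rw [Finset.sum_mul, Finset.mul_sum]
      rw [Finset.sum_congr rfl fun a _ => Finset.sum_comm, Finset.sum_comm]
      refine Finset.sum_congr rfl fun x _ => ?_
      rw [Finset.sum_congr rfl fun a _ => Finset.sum_comm, Finset.sum_comm]
      refine Finset.sum_congr rfl fun y _ => Finset.sum_congr rfl fun a _ => ?_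
      rw [← Finset.mul_sum, sum_phase_prod hω p hp]
      split_ifs <;> push_cast <;> ring
    have hre := congrArg Complex.re hcx
    rw [Complex.ofReal_re, Complex.re_ofReal_mul, Complex.re_sum] at hre
    rw [hre]
    congr 1
    refine Finset.sum_congr rfl fun z _ => ?_
    rw [Complex.re_mul_ofReal, hc]
    dsimp only
    split_ifs
    · rfl
    · rw [zero_mul, mul_zero]
  -- Taking the exponential mean turns `p^t` into `∏ (t j)!`: the left side becomes the trace over
  -- the symmetric subspace times `ℓ!`, and each type contributes `ε ℓ!` on the right.
  have hfact := sum_mul_prod_factorial_le Finset.univ _ c _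
    (fun z => wordType z.1) (fun t => t) hpoly
  simp_rw [mul_assoc] at hfact
  rw [← Finset.mul_sum, sum_multinomial_mul_factorial] at hfact
  have hC : ∑ z, c z * ∏ j, ((wordType z.1 j).factorial : ℝ) =
      ∑ a, (∑ π : Equiv.Perm (Fin ℓ), ∑ x, K a x * star (K a (x ∘ π))).re := by
    simp_rw [sum_perm_mul_star_eq]
    rw [← Complex.re_sum, Finset.sum_comm, Fintype.sum_prod_type, Complex.re_sum]
    refine Finset.sum_congr rfl fun x _ => ?_
    rw [Finset.sum_comm, Complex.re_sum]
    refine Finset.sum_congr rfl fun y _ => ?_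
    rw [← Finset.sum_mul, hc]
    dsimp only
    split_ifs with hxy
    · simp_rw [← Complex.ofReal_natCast]
      rw [← Complex.ofReal_prod, Complex.re_mul_ofReal]
    · simp
  rw [hC] at hfact
  have h4 : (0 : ℝ) < ℓ.factorial := by positivity
  have hcard : ((Finset.piAntidiag (Finset.univ : Finset n) ℓ).card : ℝ) ≤
      ((ℓ : ℝ) + 1) ^ Fintype.card n := by
    exact_mod_cast card_piAntidiag_univ_le ℓ
  refine le_of_mul_le_mul_left ?_ h4
  calc ℓ.factorial * ∑ a, ‖∑ x, K a x * R x‖ ^ 2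
      ≤ ∑ a, (∑ π : Equiv.Perm (Fin ℓ), ∑ x, K a x * star (K a (x ∘ π))).re *
          ∑ x, ‖R x‖ ^ 2 := by
        rw [Finset.mul_sum]
        exact Finset.sum_le_sum fun a _ => norm_sq_sum_mul_le_of_symmetric (K a) R hR
    _ ≤ ε * (((ℓ : ℝ) + 1) ^ Fintype.card n * ℓ.factorial) * ∑ x, ‖R x‖ ^ 2 := by
        rw [← Finset.sum_mul]
        refine mul_le_mul_of_nonneg_right (hfact.trans ?_) (by positivity)
        gcongr
    _ = _ := by ring

end QAVC

namespace QAVC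

/-! ### Kraus operators and tensor powers of channels -/

theorem exists_conjTranspose_mul_self {m : Type*} [Fintype m] {M : Matrix m m ℂ}
    (hM : M.PosSemidef) : ∃ S : Matrix m m ℂ, M = S.conjTranspose * S := by
  classical
  open scoped MatrixOrder in
  obtain ⟨S, hS⟩ := CStarAlgebra.nonneg_iff_eq_star_mul_self.mp hM.nonneg
  exact ⟨S, hS⟩

/-- A completely positive map has a Kraus decomposition, here in terms of matrix units. -/
theorem exists_kraus {m n : Type*} [Fintype m] [DecidableEq m] [Fintype n]
    {Φ : Matrix m m ℂ →ₗ[ℂ] Matrix n n ℂ} (hΦ : IsCompletelyPositive Φ) :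
    ∃ T : (m × n) → Matrix n m ℂ, ∀ x x' y y',
      Φ (Matrix.single x x' 1) y y' = ∑ k, T k y x * star (T k y' x') := by
  let e := Fintype.equivFin m
  -- The unnormalized maximally entangled state, with the reference system indexed by `Fin (card m)`
  -- as complete positivity is stated for `Fin k`. Its image is the Choi matrix `S† S`; the
  -- conjugated rows of `S` are the Kraus operators.
  have hpos : (Matrix.vecMulVec (fun p : Fin (Fintype.card m) × m => if e p.2 = p.1 then (1 : ℂ) else 0)
      (star fun p : Fin (Fintype.card m) × m => if e p.2 = p.1 then (1 : ℂ) else 0)).PosSemidef :=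
    Matrix.posSemidef_vecMulVec_self_star _
  have hC := (hΦ _ _ hpos).submatrix (fun p : m × n => (e p.1, p.2))
  obtain ⟨S, hS⟩ := exists_conjTranspose_mul_self hC
  refine ⟨fun k => Matrix.of fun y x => star (S k (x, y)), fun x x' y y' => ?_⟩
  have h := congrFun (congrFun hS (x, y)) (x', y')
  rw [Matrix.mul_apply] at h
  simp only [Matrix.conjTranspose_apply, Matrix.submatrix_apply] at h
  simp only [Matrix.of_apply, star_star]
  rw [← h]
  simp only [ampliation, LinearMap.coe_mk, AddHom.coe_mk, Matrix.of_apply]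
  refine congrFun (congrFun (congrArg Φ ?_) y) y'
  ext a b
  by_cases ha : a = x <;> by_cases hb : b = x' <;>
    simp [Matrix.single, Matrix.vecMulVec_apply, ha, hb, eq_comm (a := x) (b := a),
      eq_comm (a := x') (b := b)]

/-- The tensor power of a completely positive map is completely positive. -/
theorem isCompletelyPositive_tensorPowerMap {m n : Type*} [Fintype m] [DecidableEq m] [Fintype n]
    {Φ : Matrix m m ℂ →ₗ[ℂ] Matrix n n ℂ} (hΦ : IsCompletelyPositive Φ) (ℓ : ℕ) :
    IsCompletelyPositive (tensorPowerMap Φ ℓ) := by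
  classical
  obtain ⟨T, hT⟩ := exists_kraus hΦ
  intro r X hX
  -- Products of Kraus operators of `Φ` are Kraus operators of its tensor power.
  have key : ampliation (Fin r) (tensorPowerMap Φ ℓ) X =
      ∑ k : Fin ℓ → m × n,
        ((1 : Matrix (Fin r) (Fin r) ℂ) ⊗ₖ
            (Matrix.of fun y x => ∏ i, T (k i) (y i) (x i) : Matrix (Fin ℓ → n) (Fin ℓ → m) ℂ)) * X *
          ((1 : Matrix (Fin r) (Fin r) ℂ) ⊗ₖ
            (Matrix.of fun y x => ∏ i, T (k i) (y i) (x i) :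
              Matrix (Fin ℓ → n) (Fin ℓ → m) ℂ)).conjTranspose := by
    ext ⟨p, y⟩ ⟨q, y'⟩
    rw [Matrix.sum_apply]
    have hprod : ∀ x x' : Fin ℓ → m, ∏ i, Φ (Matrix.single (x i) (x' i) 1) (y i) (y' i) =
        ∑ k : Fin ℓ → m × n, (∏ i, T (k i) (y i) (x i)) * star (∏ i, T (k i) (y' i) (x' i)) := by
      intro x x'
      simp_rw [hT, star_prod, ← Finset.prod_mul_distrib]
      rw [Fintype.prod_sum]
    simp only [ampliation, tensorPowerMap, LinearMap.coe_mk, AddHom.coe_mk, Matrix.of_apply, hprod,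
      Finset.mul_sum]
    rw [Finset.sum_congr rfl fun x _ => Finset.sum_comm, Finset.sum_comm]
    refine Finset.sum_congr rfl fun k _ => ?_
    simp only [Matrix.mul_apply, Fintype.sum_prod_type, Matrix.kroneckerMap_apply,
      Matrix.conjTranspose_apply, Matrix.of_apply, Matrix.one_apply, ite_mul, one_mul, zero_mul,
      apply_ite star, star_zero, mul_ite, mul_zero, Finset.sum_ite_irrel,
      Finset.sum_const_zero, Finset.sum_ite_eq, Finset.mem_univ, if_true, Finset.sum_mul]
    rw [Finset.sum_comm]
    refine Finset.sum_congr rfl fun x' _ => Finset.sum_congr rfl fun x _ => ?_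
    ring
  rw [key]
  exact Matrix.posSemidef_sum _ fun k _ => hX.mul_mul_conjTranspose_same _

theorem isTracePreserving_tensorPowerMap {m n : Type*} [Fintype m] [DecidableEq m] [Fintype n]
    {Φ : Matrix m m ℂ →ₗ[ℂ] Matrix n n ℂ} (hΦ : IsTracePreserving Φ) (ℓ : ℕ) :
    IsTracePreserving (tensorPowerMap Φ ℓ) := by
  classical
  intro X
  have hprod : ∀ x x' : Fin ℓ → m,
      ∑ y : Fin ℓ → n, ∏ i, Φ (Matrix.single (x i) (x' i) 1) (y i) (y i) =
        if x = x' then 1 else 0 := by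
    intro x x'
    rw [← Fintype.prod_sum (fun i y => Φ (Matrix.single (x i) (x' i) 1) y y)]
    have hi : ∀ i, ∑ y, Φ (Matrix.single (x i) (x' i) 1) y y = if x i = x' i then 1 else 0 := by
      intro i
      refine (hΦ (Matrix.single (x i) (x' i) 1)).trans ?_
      split_ifs with h
      · rw [h, Matrix.trace_single_eq_same]
      · exact Matrix.trace_single_eq_of_ne _ _ _ h
    simp_rw [hi, Finset.prod_ite_zero, Finset.mem_univ, true_implies, Finset.prod_const_one,
      funext_iff]
  simp only [Matrix.trace, Matrix.diag_apply, tensorPowerMap, LinearMap.coe_mk, AddHom.coe_mk,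
    Matrix.of_apply]
  rw [Finset.sum_comm]
  refine Finset.sum_congr rfl fun x _ => ?_
  rw [Finset.sum_comm]
  simp_rw [← Finset.mul_sum, hprod]
  simp

/-- The factor `c` allows for a jammer operator `ζ` of arbitrary trace, which scales traces by `tr
ζ`. -/
theorem trace_ampliation {m n r : Type*} [Fintype m] [Fintype n] [Fintype r]
    {Φ : Matrix m m ℂ →ₗ[ℂ] Matrix n n ℂ} {c : ℂ} (hΦ : ∀ X, (Φ X).trace = c * X.trace)
    (X : Matrix (r × m) (r × m) ℂ) : (ampliation r Φ X).trace = c * X.trace := by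
  simp only [Matrix.trace, Matrix.diag_apply, Fintype.sum_prod_type, Finset.mul_sum] at hΦ ⊢
  exact Finset.sum_congr rfl fun p _ => hΦ (Matrix.of fun x y => X (p, x) (p, y))

/-! ### The channel with a fixed jammer input -/

section Jammer

variable {A J B : Type*} [Fintype A] [DecidableEq A] [Fintype J] [DecidableEq J] [Fintype B]

theorem isCompletelyPositive_fixJammer_blockMap (N : Channel (A × J) B) (ℓ : ℕ)
    {ζ : Matrix (Fin ℓ → J) (Fin ℓ → J) ℂ} (hζ : ζ.PosSemidef) :
    IsCompletelyPositive (fixJammer (blockMap N.map ℓ) ζ) := by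
  intro r X hX
  have h := isCompletelyPositive_tensorPowerMap N.completelyPositive ℓ r _
    ((hX.kronecker hζ).submatrix fun p : Fin r × (Fin ℓ → A × J) =>
      ((p.1, fun i => (p.2 i).1), fun i => (p.2 i).2))
  have heq : ampliation (Fin r) (fixJammer (blockMap N.map ℓ) ζ) X =
      ampliation (Fin r) (tensorPowerMap N.map ℓ)
        ((X ⊗ₖ ζ).submatrix (fun p : Fin r × (Fin ℓ → A × J) =>
          ((p.1, fun i => (p.2 i).1), fun i => (p.2 i).2)) fun p : Fin r × (Fin ℓ → A × J) =>
          ((p.1, fun i => (p.2 i).1), fun i => (p.2 i).2)) := by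
    ext p q
    simp only [ampliation, fixJammer, blockMap, LinearMap.coe_mk, AddHom.coe_mk, Matrix.of_apply,
      LinearMap.comp_apply]
    rfl
  rw [heq]
  exact h

theorem trace_fixJammer_blockMap (N : Channel (A × J) B) (ℓ : ℕ)
    (ζ : Matrix (Fin ℓ → J) (Fin ℓ → J) ℂ) (ρ : Matrix (Fin ℓ → A) (Fin ℓ → A) ℂ) :
    (fixJammer (blockMap N.map ℓ) ζ ρ).trace = ζ.trace * ρ.trace := by
  rw [mul_comm, ← Matrix.trace_kronecker]
  refine (isTracePreserving_tensorPowerMap N.tracePreserving ℓ _).trans ?_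
  exact Equiv.sum_comp (Equiv.arrowProdEquivProdArrow (Fin ℓ) (fun _ => A) (fun _ => J))
    fun z => (ρ ⊗ₖ ζ) z z

end Jammer

/-! ### The maximally entangled state -/

theorem maxEntangled_eq_vecMulVec (L : ℕ) :
    maxEntangled L = (1 / (L : ℂ)) •
      Matrix.vecMulVec (fun p : Fin L × Fin L => if p.1 = p.2 then (1 : ℂ) else 0)
        (star fun p : Fin L × Fin L => if p.1 = p.2 then (1 : ℂ) else 0) := by
  ext p q
  by_cases hp : p.1 = p.2 <;> by_cases hq : q.1 = q.2 <;>
    simp [maxEntangled, Matrix.vecMulVec_apply, hp, hq]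

theorem maxEntangled_posSemidef (L : ℕ) : (maxEntangled L).PosSemidef := by
  rw [maxEntangled_eq_vecMulVec]
  refine (Matrix.posSemidef_vecMulVec_self_star _).smul ?_
  rw [one_div]
  exact inv_nonneg.2 (Nat.cast_nonneg L)

theorem trace_maxEntangled {L : ℕ} (hL : L ≠ 0) : (maxEntangled L).trace = 1 := by
  have : (L : ℂ) ≠ 0 := Nat.cast_ne_zero.2 hL
  simp [Matrix.trace, maxEntangled, Fintype.sum_prod_type, this]

theorem maxEntangled_mul_self (L : ℕ) : maxEntangled L * maxEntangled L = maxEntangled L := by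
  rcases eq_or_ne L 0 with rfl | hL
  · ext p
    exact p.1.elim0
  have : (L : ℂ) ≠ 0 := Nat.cast_ne_zero.2 hL
  ext p q
  by_cases hp : p.1 = p.2 <;> by_cases hq : q.1 = q.2 <;>
    simp [maxEntangled, Matrix.mul_apply, Fintype.sum_prod_type, hp, hq, this]

theorem one_sub_maxEntangled_posSemidef (L : ℕ) : (1 - maxEntangled L).PosSemidef := by
  have hH : (maxEntangled L).conjTranspose = maxEntangled L := (maxEntangled_posSemidef L).1
  have h : 1 - maxEntangled L = (1 - maxEntangled L).conjTranspose * (1 - maxEntangled L) := by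
    rw [Matrix.conjTranspose_sub, Matrix.conjTranspose_one, hH, mul_sub, sub_mul, sub_mul,
      maxEntangled_mul_self]
    simp
  rw [h]
  exact Matrix.posSemidef_conjTranspose_mul_self _

theorem trace_mul_nonneg {m : Type*} [Fintype m] {X Y : Matrix m m ℂ} (hX : X.PosSemidef)
    (hY : Y.PosSemidef) : 0 ≤ (X * Y).trace := by
  obtain ⟨S, rfl⟩ := exists_conjTranspose_mul_self hY
  rw [← mul_assoc, Matrix.trace_mul_comm, ← mul_assoc]
  exact (hX.mul_mul_conjTranspose_same S).trace_nonneg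

end QAVC

namespace QAVC

/-! ### Positive functionals -/

/-- Over `ℂ` a quadratic form with real values already forces the operator to be Hermitian. -/
theorem posSemidef_of_forall_nonneg {m : Type*} [Fintype m] [DecidableEq m] {M : Matrix m m ℂ}
    (h : ∀ v : m → ℂ, 0 ≤ star v ⬝ᵥ (M.mulVec v)) : M.PosSemidef := by
  rw [← Matrix.isPositive_toEuclideanLin_iff, LinearMap.isPositive_iff_complex]
  intro v
  have hv := h v.ofLp
  have heq : inner ℂ (M.toEuclideanLin v) v = star (star v.ofLp ⬝ᵥ (M.mulVec v.ofLp)) := by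
    rw [← Matrix.star_dotProduct, dotProduct_comm, EuclideanSpace.inner_eq_star_dotProduct]
    rfl
  rw [Complex.nonneg_iff] at hv
  rw [heq]
  refine ⟨Complex.ext ?_ ?_, ?_⟩
  · simp
  · simp [← hv.2]
  · simpa using hv.1

theorem trace_mul_conjTranspose_self {m : Type*} [Fintype m] (R : Matrix m m ℂ) :
    (R * R.conjTranspose).trace = ((∑ z : m × m, ‖R z.1 z.2‖ ^ 2 : ℝ) : ℂ) := by
  rw [Complex.ofReal_sum, Fintype.sum_prod_type]
  simp only [Matrix.trace, Matrix.diag_apply, Matrix.mul_apply, Matrix.conjTranspose_apply]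
  refine Finset.sum_congr rfl fun a _ => Finset.sum_congr rfl fun b _ => ?_
  rw [Complex.ofReal_pow, ← Complex.mul_conj']
  rfl

/-- A functional on operators that is nonnegative on positive ones is `R ↦ ‖S R‖²` on `R R†`. -/
theorem exists_apply_mul_conjTranspose_eq {m : Type*} [Fintype m]
    (F : Matrix m m ℂ →ₗ[ℂ] ℂ) (hF : ∀ X : Matrix m m ℂ, X.PosSemidef → 0 ≤ F X) :
    ∃ S : Matrix m m ℂ, ∀ R : Matrix m m ℂ,
      F (R * R.conjTranspose) = ((∑ z : m × m, ‖(S * R) z.1 z.2‖ ^ 2 : ℝ) : ℂ) := by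
  classical
  -- The indices are swapped so that `F X = tr (M X)`; testing `F` on rank-one operators then shows
  -- that `M` is positive.
  let M : Matrix m m ℂ := Matrix.of fun x y => F (Matrix.single y x 1)
  have hM : ∀ X, F X = (M * X).trace := by
    intro X
    conv_lhs => rw [Matrix.matrix_eq_sum_single X]
    have : ∀ x x', Matrix.single x x' (X x x') = X x x' • Matrix.single x x' (1 : ℂ) := by
      intro x x'
      rw [Matrix.smul_single, smul_eq_mul, mul_one]
    simp_rw [this, map_sum, map_smul, smul_eq_mul, Matrix.trace, Matrix.diag_apply,
      Matrix.mul_apply]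
    rw [Finset.sum_comm]
    exact Finset.sum_congr rfl fun x _ => Finset.sum_congr rfl fun y _ => mul_comm _ _
  have hpos : M.PosSemidef := by
    refine posSemidef_of_forall_nonneg fun v => ?_
    have := hF _ (Matrix.posSemidef_vecMulVec_self_star v)
    rwa [hM, Matrix.mul_vecMulVec, Matrix.trace_vecMulVec, dotProduct_comm] at this
  obtain ⟨S, hS⟩ := exists_conjTranspose_mul_self hpos
  refine ⟨S, fun R => ?_⟩
  rw [hM, hS, ← mul_assoc, Matrix.trace_mul_comm, ← mul_assoc, ← mul_assoc,
    ← Matrix.conjTranspose_mul, mul_assoc, Matrix.trace_mul_comm]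
  exact trace_mul_conjTranspose_self (S * R)

/-! ### Tensor powers of operators -/

section TensorPower

variable {J : Type*}

theorem tensorPower_mul_conjTranspose [Fintype J] [DecidableEq J] (W : Matrix J J ℂ) (ℓ : ℕ) :
    tensorPower W ℓ * (tensorPower W ℓ).conjTranspose =
      tensorPower (W * W.conjTranspose) ℓ := by
  ext x y
  simp only [tensorPower, Matrix.mul_apply, Matrix.conjTranspose_apply, Matrix.of_apply,
    star_prod, ← Finset.prod_mul_distrib]
  rw [Fintype.prod_sum]

theorem tensorPower_smul (c : ℂ) (σ : Matrix J J ℂ) (ℓ : ℕ) :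
    tensorPower (c • σ) ℓ = c ^ ℓ • tensorPower σ ℓ := by
  ext x y
  simp [tensorPower, Finset.prod_mul_distrib]

/-- Every positive operator is a multiple of a state. -/
theorem exists_state_smul_eq [Fintype J] [DecidableEq J] [Nonempty J] {P : Matrix J J ℂ}
    (hP : P.PosSemidef) : ∃ σ : Matrix J J ℂ, IsState σ ∧ P = P.trace • σ := by
  by_cases h : P.trace = 0
  · obtain ⟨j⟩ := ‹Nonempty J›
    refine ⟨Matrix.vecMulVec (Pi.single j 1) (star (Pi.single j 1)),
      ⟨Matrix.posSemidef_vecMulVec_self_star _, ?_⟩, ?_⟩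
    · rw [Matrix.trace_vecMulVec]
      simp
    · rw [h, zero_smul]
      exact hP.trace_eq_zero_iff.1 h
  · refine ⟨P.trace⁻¹ • P, ⟨hP.smul (inv_nonneg.2 hP.trace_nonneg), ?_⟩, ?_⟩
    · rw [Matrix.trace_smul, smul_eq_mul, inv_mul_cancel₀ h]
    · rw [smul_smul, mul_inv_cancel₀ h, one_smul]

/-- The action of a permutation on operators on a tensor power. -/
def permuteOperator {ℓ : ℕ} (π : Equiv.Perm (Fin ℓ)) (X : Matrix (Fin ℓ → J) (Fin ℓ → J) ℂ) :
    Matrix (Fin ℓ → J) (Fin ℓ → J) ℂ :=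
  X.submatrix (fun x => x ∘ π) (fun x => x ∘ π)

theorem permuteOperator_mul [Fintype J] {ℓ : ℕ} (π : Equiv.Perm (Fin ℓ))
    (X Y : Matrix (Fin ℓ → J) (Fin ℓ → J) ℂ) :
    permuteOperator π X * permuteOperator π Y = permuteOperator π (X * Y) :=
  Matrix.submatrix_mul_equiv X Y _ (π.symm.arrowCongr (Equiv.refl J)) _

/-- The average of an operator over all permutations. -/
noncomputable def symmetrize {ℓ : ℕ} (ζ : Matrix (Fin ℓ → J) (Fin ℓ → J) ℂ) :
    Matrix (Fin ℓ → J) (Fin ℓ → J) ℂ :=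
  ((ℓ.factorial : ℝ)⁻¹ : ℂ) • ∑ π : Equiv.Perm (Fin ℓ), permuteOperator π ζ

theorem trace_permuteOperator [Fintype J] {ℓ : ℕ} (π : Equiv.Perm (Fin ℓ))
    (ζ : Matrix (Fin ℓ → J) (Fin ℓ → J) ℂ) : (permuteOperator π ζ).trace = ζ.trace :=
  Equiv.sum_comp (π.symm.arrowCongr (Equiv.refl J)) fun x => ζ x x

theorem isState_symmetrize [Fintype J] {ℓ : ℕ} {ζ : Matrix (Fin ℓ → J) (Fin ℓ → J) ℂ} (hζ : IsState ζ) :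
    IsState (symmetrize ζ) := by
  constructor
  · refine (Matrix.posSemidef_sum _ fun π _ => hζ.1.submatrix _).smul ?_
    rw [← Complex.ofReal_inv]
    exact Complex.zero_le_real.2 (by positivity)
  · have h : (ℓ.factorial : ℂ) ≠ 0 := Nat.cast_ne_zero.2 ℓ.factorial_ne_zero
    rw [symmetrize, Matrix.trace_smul, Matrix.trace_sum]
    simp [trace_permuteOperator, hζ.2, Fintype.card_perm, h]

theorem permuteOperator_symmetrize {ℓ : ℕ} (π : Equiv.Perm (Fin ℓ))
    (ζ : Matrix (Fin ℓ → J) (Fin ℓ → J) ℂ) :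
    permuteOperator π (symmetrize ζ) = symmetrize ζ := by
  ext x y
  simp only [permuteOperator, symmetrize, Matrix.submatrix_apply, Matrix.smul_apply,
    Matrix.sum_apply]
  congr 1
  exact Equiv.sum_comp (Equiv.mulLeft π) fun ρ : Equiv.Perm (Fin ℓ) => ζ (x ∘ ρ) (y ∘ ρ)

theorem trace_tensorPower [Fintype J] (σ : Matrix J J ℂ) (ℓ : ℕ) :
    (tensorPower σ ℓ).trace = σ.trace ^ ℓ := by
  simp only [Matrix.trace, Matrix.diag_apply, tensorPower, Matrix.of_apply]
  rw [← Fintype.prod_sum (fun (_ : Fin ℓ) j => σ j j)]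
  simp

/-- A permutation invariant positive operator has a permutation invariant square root. -/
theorem exists_symmetric_sqrt [Fintype J] {ℓ : ℕ} {ζ : Matrix (Fin ℓ → J) (Fin ℓ → J) ℂ}
    (hζ : ζ.PosSemidef) (hsymm : ∀ π, permuteOperator π ζ = ζ) :
    ∃ R : Matrix (Fin ℓ → J) (Fin ℓ → J) ℂ, ζ = R * R.conjTranspose ∧
      ∀ π, permuteOperator π R = R := by
  classical
  open scoped MatrixOrder in
  have hnn : (0 : Matrix (Fin ℓ → J) (Fin ℓ → J) ℂ) ≤ ζ := hζ.nonneg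
  open scoped MatrixOrder in
  have hR : (CFC.sqrt ζ).PosSemidef := 
    Matrix.nonneg_iff_posSemidef.1 (CFC.sqrt_nonneg ζ)
  open scoped MatrixOrder in
  have hRR : CFC.sqrt ζ * CFC.sqrt ζ = ζ := CFC.sqrt_mul_sqrt_self ζ hnn
  refine ⟨CFC.sqrt ζ, ?_, fun π => ?_⟩
  · rw [hR.1.eq, hRR]
  · open scoped MatrixOrder in
    -- The permuted root is a positive square root of the permuted `ζ`, which is `ζ` itself.
    refine (CFC.sqrt_unique ?_ ?_).symm
    · rw [permuteOperator_mul, hRR, hsymm]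
    · exact (hR.submatrix _).nonneg

/-- A positive functional that is at most `ε` on tensor powers of states is at most
`ε (ℓ + 1) ^ |J|²` on permutation invariant states. -/
theorem re_apply_le_of_symmetric [Fintype J] [DecidableEq J] [Nonempty J] {ℓ : ℕ}
    (F : Matrix (Fin ℓ → J) (Fin ℓ → J) ℂ →ₗ[ℂ] ℂ)
    (hF : ∀ X : Matrix (Fin ℓ → J) (Fin ℓ → J) ℂ, X.PosSemidef → 0 ≤ F X) (ε : ℝ)
    (hε : ∀ σ : Matrix J J ℂ, IsState σ → (F (tensorPower σ ℓ)).re ≤ ε)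
    {ζ : Matrix (Fin ℓ → J) (Fin ℓ → J) ℂ} (hζ : IsState ζ)
    (hsymm : ∀ π, permuteOperator π ζ = ζ) :
    (F ζ).re ≤ ε * ((ℓ : ℝ) + 1) ^ (Fintype.card J ^ 2) := by
  obtain ⟨S, hS⟩ := exists_apply_mul_conjTranspose_eq F hF
  obtain ⟨R, hR, hRsymm⟩ := exists_symmetric_sqrt hζ.1 hsymm
  let e := Equiv.arrowProdEquivProdArrow (Fin ℓ) (fun _ => J) (fun _ => J)
  -- Operators on `J^ℓ` become tensors over words in the alphabet `J × J`, and `K z` is the entry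
  -- `z` of left multiplication by `S`. Tensor powers of operators become powers of vectors.
  let K : (Fin ℓ → J) × (Fin ℓ → J) → (Fin ℓ → J × J) → ℂ := fun z x =>
    S z.1 (e x).1 * if (e x).2 = z.2 then 1 else 0
  have hK : ∀ (T : Matrix (Fin ℓ → J) (Fin ℓ → J) ℂ) z,
      ∑ x, K z x * T (e x).1 (e x).2 = (S * T) z.1 z.2 := by
    intro T z
    rw [Equiv.sum_comp e fun y => (S z.1 y.1 * if y.2 = z.2 then 1 else 0) * T y.1 y.2,
      Fintype.sum_prod_type, Matrix.mul_apply]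
    simp
  have hnorm : ∑ x, ‖R (e x).1 (e x).2‖ ^ 2 = 1 := by
    rw [Equiv.sum_comp e fun y => ‖R y.1 y.2‖ ^ 2]
    have := trace_mul_conjTranspose_self R
    rw [← hR, hζ.2] at this
    exact_mod_cast this.symm
  have hw : ∀ w : J × J → ℂ,
      ∑ z, ‖∑ x, K z x * ∏ i, w (x i)‖ ^ 2 ≤ ε * (∑ j, ‖w j‖ ^ 2) ^ ℓ := by
    intro w
    let W : Matrix J J ℂ := Matrix.of fun a b => w (a, b)
    have h1 : ∀ z, ∑ x, K z x * ∏ i, w (x i) = (S * tensorPower W ℓ) z.1 z.2 :=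
      fun z => hK (tensorPower W ℓ) z
    have h2 := hS (tensorPower W ℓ)
    -- Since `W W† = ‖w‖² σ`, the form at `w^{⊗ℓ}` is `‖w‖^{2ℓ} F(σ^{⊗ℓ})`.
    obtain ⟨σ, hσ, hWσ⟩ := exists_state_smul_eq (Matrix.posSemidef_self_mul_conjTranspose W)
    have h3 := trace_mul_conjTranspose_self W
    rw [h3] at hWσ
    rw [tensorPower_mul_conjTranspose, hWσ, tensorPower_smul, map_smul, smul_eq_mul,
      ← Complex.ofReal_pow] at h2
    have h4 := congrArg Complex.re h2
    rw [Complex.re_ofReal_mul, Complex.ofReal_re] at h4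
    simp_rw [h1]
    rw [← h4, mul_comm]
    exact mul_le_mul_of_nonneg_right (hε σ hσ) (by positivity)
  -- `F` is nonnegative on the tensor power of any state; the decomposition of the zero operator
  -- supplies one.
  have hε0 : 0 ≤ ε := by
    obtain ⟨σ, hσ, -⟩ := exists_state_smul_eq (Matrix.PosSemidef.zero (n := J) (R := ℂ))
    obtain ⟨T, rfl⟩ := exists_conjTranspose_mul_self hσ.1
    have h := tensorPower_mul_conjTranspose T.conjTranspose ℓ
    rw [Matrix.conjTranspose_conjTranspose] at h
    refine le_trans ?_ (hε _ hσ)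
    rw [← h]
    exact (Complex.nonneg_iff.1 (hF _ (Matrix.posSemidef_self_mul_conjTranspose _))).1
  have hmain := sum_norm_sq_le_of_symmetric K ε hε0 hw (fun x => R (e x).1 (e x).2)
    fun π x => congrFun (congrFun (hRsymm π) (e x).1) (e x).2
  simp_rw [hK] at hmain
  rw [hnorm, mul_one, Fintype.card_prod, ← sq] at hmain
  rw [hR, hS, Complex.ofReal_re]
  exact hmain

end TensorPower

/-! ### The error functional of a code -/

section Code

variable {A J B : Type*} [Fintype A] [DecidableEq A] [Fintype J] [DecidableEq J] [Fintype B]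

/-- The infidelity of a code as a linear functional of the jammer's operator. -/
noncomputable def errorFunctional (N : Channel (A × J) B) {ℓ L : ℕ} (Q : QuantumCode A B ℓ L) :
    Matrix (Fin ℓ → J) (Fin ℓ → J) ℂ →ₗ[ℂ] ℂ where
  toFun ζ := ζ.trace -
    (ampliation (Fin L) (Q.dec.map ∘ₗ fixJammer (blockMap N.map ℓ) ζ ∘ₗ Q.enc.map)
      (maxEntangled L) * maxEntangled L).trace
  map_add' ζ ζ' := by
    have h : ampliation (Fin L)
          (Q.dec.map ∘ₗ fixJammer (blockMap N.map ℓ) (ζ + ζ') ∘ₗ Q.enc.map) (maxEntangled L) =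
        ampliation (Fin L) (Q.dec.map ∘ₗ fixJammer (blockMap N.map ℓ) ζ ∘ₗ Q.enc.map)
          (maxEntangled L) +
        ampliation (Fin L) (Q.dec.map ∘ₗ fixJammer (blockMap N.map ℓ) ζ' ∘ₗ Q.enc.map)
          (maxEntangled L) := by
      ext p q
      simp [ampliation, fixJammer, Matrix.kronecker_add]
    rw [h, add_mul, Matrix.trace_add, Matrix.trace_add]
    ring
  map_smul' c ζ := by
    have h : ampliation (Fin L)
          (Q.dec.map ∘ₗ fixJammer (blockMap N.map ℓ) (c • ζ) ∘ₗ Q.enc.map) (maxEntangled L) =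
        c • ampliation (Fin L) (Q.dec.map ∘ₗ fixJammer (blockMap N.map ℓ) ζ ∘ₗ Q.enc.map)
          (maxEntangled L) := by
      ext p q
      simp [ampliation, fixJammer, Matrix.kronecker_smul]
    rw [h, Matrix.smul_mul, Matrix.trace_smul, Matrix.trace_smul, smul_eq_mul, smul_eq_mul,
      RingHom.id_apply, smul_eq_mul, mul_sub]

theorem infidelity_eq_re_errorFunctional (N : Channel (A × J) B) {ℓ L : ℕ}
    (Q : QuantumCode A B ℓ L) {ζ : Matrix (Fin ℓ → J) (Fin ℓ → J) ℂ} (hζ : ζ.trace = 1) :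
    infidelity N Q ζ = (errorFunctional N Q ζ).re := by
  simp only [infidelity, errorFunctional, LinearMap.coe_mk, AddHom.coe_mk, hζ, Complex.sub_re,
    Complex.one_re]

/-- The output `Y` has trace `tr ζ`, so the functional equals `tr (Y (1 - Φ_L))`, a trace of a
product of two positive operators. -/
theorem errorFunctional_nonneg (N : Channel (A × J) B) {ℓ L : ℕ} (Q : QuantumCode A B ℓ L)
    {ζ : Matrix (Fin ℓ → J) (Fin ℓ → J) ℂ} (hζ : ζ.PosSemidef) :
    0 ≤ errorFunctional N Q ζ := by
  set Y := ampliation (Fin L) (Q.dec.map ∘ₗ fixJammer (blockMap N.map ℓ) ζ ∘ₗ Q.enc.map)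
    (maxEntangled L) with hY
  have hYpos : Y.PosSemidef :=
    Q.dec.completelyPositive L _ (isCompletelyPositive_fixJammer_blockMap N ℓ hζ L _
      (Q.enc.completelyPositive L _ (maxEntangled_posSemidef L)))
  change 0 ≤ ζ.trace - (Y * maxEntangled L).trace
  -- For `L = 0` the state `Φ_0` has trace zero and the trace identity fails, but the functional is
  -- then just `tr ζ`.
  rcases eq_or_ne L 0 with rfl | hL
  · have : (Y * maxEntangled 0).trace = 0 := by simp [Matrix.trace]
    rw [this, sub_zero]
    exact hζ.trace_nonneg
  · have htr : Y.trace = ζ.trace := by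
      rw [hY, trace_ampliation (c := ζ.trace), trace_maxEntangled hL, mul_one]
      intro X
      refine (Q.dec.tracePreserving _).trans ?_
      exact (trace_fixJammer_blockMap N ℓ ζ _).trans (by rw [Q.enc.tracePreserving])
    rw [← htr, ← Matrix.trace_sub]
    have := trace_mul_nonneg hYpos (one_sub_maxEntangled_posSemidef L)
    rwa [mul_sub, mul_one] at this

/-! ### Permutation covariance and the averaged infidelity -/

theorem conjMap_permOp {m : Type*} [Fintype m] [DecidableEq m] {ℓ : ℕ} (π : Equiv.Perm (Fin ℓ))
    (X : Matrix (Fin ℓ → m) (Fin ℓ → m) ℂ) :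
    conjMap (permOp m π) X = permuteOperator π X := by
  ext y y'
  have h : ∀ x y : Fin ℓ → m, (y = x ∘ ⇑π⁻¹) ↔ x = y ∘ ⇑π := by
    intro x y
    constructor
    · rintro rfl
      funext i
      simp
    · rintro rfl
      funext i
      simp
  simp only [conjMap, permOp, permuteOperator, LinearMap.coe_mk, AddHom.coe_mk, Matrix.mul_apply,
    Matrix.conjTranspose_apply, Matrix.of_apply, Matrix.submatrix_apply, h]
  simp [apply_ite star]

theorem tensorPowerMap_permuteOperator {m n : Type*} [Fintype m] [DecidableEq m]
    (Φ : Matrix m m ℂ →ₗ[ℂ] Matrix n n ℂ) {ℓ : ℕ} (π : Equiv.Perm (Fin ℓ))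
    (X : Matrix (Fin ℓ → m) (Fin ℓ → m) ℂ) :
    tensorPowerMap Φ ℓ (permuteOperator π X) = permuteOperator π (tensorPowerMap Φ ℓ X) := by
  ext y y'
  simp only [tensorPowerMap, permuteOperator, LinearMap.coe_mk, AddHom.coe_mk, Matrix.of_apply,
    Matrix.submatrix_apply]
  let e : (Fin ℓ → m) ≃ (Fin ℓ → m) := π.symm.arrowCongr (Equiv.refl m)
  rw [← Equiv.sum_comp e fun x => ∑ x', X x x' * ∏ i, Φ (Matrix.single (x i) (x' i) 1)
    ((y ∘ π) i) ((y' ∘ π) i)]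
  refine Finset.sum_congr rfl fun x _ => ?_
  rw [← Equiv.sum_comp e fun x' => X (e x) x' * ∏ i, Φ (Matrix.single (e x i) (x' i) 1)
    ((y ∘ π) i) ((y' ∘ π) i)]
  refine Finset.sum_congr rfl fun x' _ => ?_
  rw [← Equiv.prod_comp π fun i => Φ (Matrix.single (x i) (x' i) 1) (y i) (y' i)]
  rfl

/-- By covariance `π⁻¹` moves from the output to both inputs; it cancels `π` on the sender's side
and remains on the jammer's. -/
theorem fixJammer_permute (N : Channel (A × J) B) {ℓ : ℕ} (π : Equiv.Perm (Fin ℓ))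
    (ζ : Matrix (Fin ℓ → J) (Fin ℓ → J) ℂ) (ρ : Matrix (Fin ℓ → A) (Fin ℓ → A) ℂ) :
    permuteOperator π⁻¹ (fixJammer (blockMap N.map ℓ) ζ (permuteOperator π ρ)) =
      fixJammer (blockMap N.map ℓ) (permuteOperator π⁻¹ ζ) ρ := by
  simp only [fixJammer, blockMap, LinearMap.coe_mk, AddHom.coe_mk, LinearMap.comp_apply]
  rw [← tensorPowerMap_permuteOperator]
  congr 1
  ext x x'
  have h : ∀ u : Fin ℓ → A, (u ∘ ⇑π⁻¹) ∘ ⇑π = u := by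
    intro u
    funext i
    simp
  exact congrArg₂ (· * ·) (congrArg₂ ρ (h fun i => (x i).1) (h fun i => (x' i).1)) rfl

theorem infidelity_permute [DecidableEq B] (N : Channel (A × J) B) {ℓ L : ℕ}
    (Q : QuantumCode A B ℓ L) (π : Equiv.Perm (Fin ℓ)) (ζ : Matrix (Fin ℓ → J) (Fin ℓ → J) ℂ) :
    infidelity N (Q.permute π) ζ = infidelity N Q (permuteOperator π⁻¹ ζ) := by
  have h : (Q.permute π).dec.map ∘ₗ fixJammer (blockMap N.map ℓ) ζ ∘ₗ (Q.permute π).enc.map =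
      Q.dec.map ∘ₗ fixJammer (blockMap N.map ℓ) (permuteOperator π⁻¹ ζ) ∘ₗ Q.enc.map := by
    refine LinearMap.ext fun X => ?_
    change Q.dec.map (conjMap (permOp B π⁻¹) (fixJammer (blockMap N.map ℓ) ζ
      (conjMap (permOp A π) (Q.enc.map X)))) = _
    rw [conjMap_permOp, conjMap_permOp, fixJammer_permute]
    rfl
  rw [infidelity, infidelity, h]

theorem randomInfidelity_permute [DecidableEq B] (N : Channel (A × J) B) {ℓ L : ℕ}
    (Q : QuantumCode A B ℓ L) {ζ : Matrix (Fin ℓ → J) (Fin ℓ → J) ℂ} (hζ : ζ.trace = 1) :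
    randomInfidelity N (fun π : Equiv.Perm (Fin ℓ) => Q.permute π) ζ =
      (errorFunctional N Q (symmetrize ζ)).re := by
  -- The code permuted by `π` sees `ζ` permuted by `π⁻¹`, hence the reindexing of the sum by
  -- inversion.
  rw [randomInfidelity, symmetrize, map_smul, map_sum, smul_eq_mul, ← Complex.ofReal_inv,
    Complex.re_ofReal_mul, Complex.re_sum, Fintype.card_perm, Fintype.card_fin, div_eq_inv_mul,
    ← Equiv.sum_comp (Equiv.inv (Equiv.Perm (Fin ℓ)))]
  congr 1
  refine Finset.sum_congr rfl fun π _ => ?_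
  rw [infidelity_permute, infidelity_eq_re_errorFunctional N Q
    ((trace_permuteOperator _ ζ).trans hζ)]
  simp

end Code

end QAVC

theorem proposition1 {A J B : Type*} [Fintype A] [DecidableEq A] [Fintype J] [DecidableEq J]
    [Nonempty J] [Fintype B] [DecidableEq B] (N : QAVC.Channel (A × J) B) {ℓ L : ℕ}
    (Q : QAVC.QuantumCode A B ℓ L) (ε : ℝ)
    (hQ : ∀ σ : Matrix J J ℂ, QAVC.IsState σ →
      QAVC.infidelity N Q (QAVC.tensorPower σ ℓ) ≤ ε) :
    ∀ ζ : Matrix (Fin ℓ → J) (Fin ℓ → J) ℂ, QAVC.IsState ζ →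
      QAVC.randomInfidelity N (fun π : Equiv.Perm (Fin ℓ) => Q.permute π) ζ ≤
        ε * ((ℓ : ℝ) + 1) ^ (Fintype.card J ^ 2) := by
  intro ζ hζ
  rw [QAVC.randomInfidelity_permute N Q hζ.2]
  refine QAVC.re_apply_le_of_symmetric _ (fun X hX => QAVC.errorFunctional_nonneg N Q hX) ε
    (fun σ hσ => ?_) (QAVC.isState_symmetrize hζ) fun π => QAVC.permuteOperator_symmetrize π ζ
  rw [← QAVC.infidelity_eq_re_errorFunctional N Q (by
    rw [QAVC.trace_tensorPower, hσ.2, one_pow])]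
  exact hQ σ hσ
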